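/- Let $\mathbb F$ be an arbitrary field and let $E=\mathbb F^2$ be the natural representation of $\mathrm{SL}_2(\mathbb F)$. For $d\ge 0$ let $\operatorname{Sym}^d E$ be the space of homogeneous polynomials of degree $d$ in two variables $X,Y$ over $\mathbb F$, on which $\begin{pmatrix} a&b\\c&e\end{pmatrix}\in \mathrm{SL}_2(\mathbb F)$ acts by $P(X,Y)\mapsto P(aX+cY,\,bX+eY)$. For a representation $V$ of $\mathrm{SL}_2(\mathbb F)$ and $n\ge 0$ let $\operatorname{Sym}_n V\subseteq V^{\otimes n}$ be the subrepresentation of all tensors fixed by every permutation in $\mathfrak S_n$ of the $n$ tensor positions (so $\operatorname{Sym}_0V\cong\mathbb F$ is trivial), where $\mathrm{SL}_2(\mathbb F)$ acts diagonally on $V^{\otimes n}$. Then for all integers $K,d\ge 0$ there exist isomorphisms of representations of $\mathrm{SL}_2(\mathbb F)$: (i) $\operatorname{Sym}^{d+K}E\otimes \operatorname{Sym}_K\operatorname{Sym}^dE\;\cong\;\operatorname{Sym}^KE\otimes\operatorname{Sym}_{K+1}\operatorname{Sym}^dE$; (ii) $\operatorname{Sym}_KE\otimes\operatorname{Sym}_{K+1}\operatorname{Sym}^dE\;\cong\;\operatorname{Sym}^dE\otimes\operatorname{Sym}_K\operatorname{Sym}^{d+1}E$;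 (iii) $\operatorname{Sym}_{d+K}E\otimes\operatorname{Sym}_K\operatorname{Sym}^dE\;\cong\;\operatorname{Sym}_dE\otimes\operatorname{Sym}_K\operatorname{Sym}^{d+1}E$. -/

import Mathlib

open scoped TensorProduct

namespace SL2Plethysm

section LowerSymmetricPowers

/-- The tensor power `V^{⊗ n}` of a representation `V` of `G`, with the diagonal action
`g • (v₁ ⊗ ⋯ ⊗ vₙ) = g v₁ ⊗ ⋯ ⊗ g vₙ`. -/
noncomputable def tensorPower {k G V : Type*} [CommRing k] [Group G] [AddCommGroup V] [Module k V]
    (ρ : Representation k G V) (n : ℕ) : Representation k G (⨂[k] _ : Fin n, V) where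
  toFun g := PiTensorProduct.map fun _ => ρ g
  map_one' := by
    simp only [map_one]
    exact PiTensorProduct.map_one
  map_mul' g h := by
    simp only [map_mul]
    exact PiTensorProduct.map_mul (fun _ => ρ g) (fun _ => ρ h)

/-- The lower symmetric power `Sym_n V ⊆ V^{⊗ n}`: the tensors fixed by every place permutation.
Here `PiTensorProduct.reindex k (fun _ => V) σ` is the place permutation
`v₁ ⊗ ⋯ ⊗ vₙ ↦ v_{σ⁻¹(1)} ⊗ ⋯ ⊗ v_{σ⁻¹(n)}`. -/
noncomputable def lowerSymSubmodule (k V : Type*) [CommRing k] [AddCommGroup V] [Module k V]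
    (n : ℕ) : Submodule k (⨂[k] _ : Fin n, V) where
  carrier := {w | ∀ σ : Equiv.Perm (Fin n), PiTensorProduct.reindex k (fun _ => V) σ w = w}
  add_mem' hv hw σ := by rw [map_add, hv σ, hw σ]
  zero_mem' σ := map_zero _
  smul_mem' c w hw σ := by rw [map_smul, hw σ]

theorem lowerSymSubmodule_le_comap {k G V : Type*} [CommRing k] [Group G] [AddCommGroup V]
    [Module k V] (ρ : Representation k G V) (n : ℕ) (g : G) :
    lowerSymSubmodule k V n ≤ (lowerSymSubmodule k V n).comap (tensorPower ρ n g) := by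
  intro w hw σ
  have h := PiTensorProduct.map_reindex (R := k) (fun _ : Fin n => ρ g) σ w
  rw [hw σ] at h
  exact h.symm

/-- The lower symmetric power `Sym_n V` of a representation `V`, as a subrepresentation of
`V^{⊗ n}`. -/
noncomputable def lowerSym {k G V : Type*} [CommRing k] [Group G] [AddCommGroup V] [Module k V]
    (ρ : Representation k G V) (n : ℕ) : Representation k G (lowerSymSubmodule k V n) :=
  (tensorPower ρ n).subrepresentation (lowerSymSubmodule k V n) (lowerSymSubmodule_le_comap ρ n)

end LowerSymmetricPowers

section SL2

/-- The natural representation `E` of `SL₂(F)` on column vectors. -/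
noncomputable def natural (F : Type*) [Field F] :
    Representation F (Matrix.SpecialLinearGroup (Fin 2) F) (Fin 2 → F) where
  toFun g := Matrix.toLin' g.1
  map_one' := by
    rw [Matrix.SpecialLinearGroup.coe_one, Matrix.toLin'_one]; rfl
  map_mul' g h := by
    rw [Matrix.SpecialLinearGroup.coe_mul, Matrix.toLin'_mul]; rfl

/-- The algebra endomorphism of `F[X, Y]` (with `X = X 0`, `Y = X 1`) attached to
`g = !![a, b; c, d]`, namely `X ↦ a X + c Y`, `Y ↦ b X + d Y`. -/
noncomputable def polySubst {F : Type*} [Field F] (g : Matrix.SpecialLinearGroup (Fin 2) F) :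
    MvPolynomial (Fin 2) F →ₐ[F] MvPolynomial (Fin 2) F :=
  MvPolynomial.aeval fun j => ∑ i, MvPolynomial.C (g.1 i j) * MvPolynomial.X i

theorem polySubst_one {F : Type*} [Field F] :
    polySubst (1 : Matrix.SpecialLinearGroup (Fin 2) F) = AlgHom.id F _ := by
  apply MvPolynomial.algHom_ext
  intro j
  fin_cases j <;> simp [polySubst]

theorem polySubst_mul {F : Type*} [Field F] (g h : Matrix.SpecialLinearGroup (Fin 2) F) :
    polySubst (g * h) = (polySubst g).comp (polySubst h) := by
  apply MvPolynomial.algHom_ext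
  intro j
  simp only [polySubst, AlgHom.comp_apply, MvPolynomial.aeval_X, Matrix.SpecialLinearGroup.coe_mul,
    Matrix.mul_apply, Fin.sum_univ_two, map_add, map_mul, MvPolynomial.algHom_C,
    MvPolynomial.algebraMap_eq]
  ring

/-- The action of `SL₂(F)` on the polynomial algebra `F[X, Y]`. -/
noncomputable def polyRep (F : Type*) [Field F] :
    Representation F (Matrix.SpecialLinearGroup (Fin 2) F) (MvPolynomial (Fin 2) F) where
  toFun g := (polySubst g).toLinearMap
  map_one' := by rw [polySubst_one]; rfl
  map_mul' g h := by rw [polySubst_mul]; rfl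

theorem homogeneousSubmodule_le_comap (F : Type*) [Field F] (d : ℕ)
    (g : Matrix.SpecialLinearGroup (Fin 2) F) :
    MvPolynomial.homogeneousSubmodule (Fin 2) F d ≤
      (MvPolynomial.homogeneousSubmodule (Fin 2) F d).comap (polyRep F g) := by
  intro p hp
  have h := MvPolynomial.IsHomogeneous.aeval (S := F) (n := 1)
    ((MvPolynomial.mem_homogeneousSubmodule d p).1 hp)
    (fun j => ∑ i, MvPolynomial.C (g.1 i j) * MvPolynomial.X i)
    (fun j => MvPolynomial.IsHomogeneous.sum _ _ _ fun i _ =>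
      (MvPolynomial.isHomogeneous_X F i).C_mul _)
  rw [one_mul] at h
  exact h

/-- The upper symmetric power `Sym^d E` of the natural representation `E` of `SL₂(F)`: the
homogeneous polynomials of degree `d` in `X, Y`, with `SL₂(F)` acting by linear substitutions. -/
noncomputable def upperSym (F : Type*) [Field F] (d : ℕ) :
    Representation F (Matrix.SpecialLinearGroup (Fin 2) F)
      (MvPolynomial.homogeneousSubmodule (Fin 2) F d) :=
  (polyRep F).subrepresentation (MvPolynomial.homogeneousSubmodule (Fin 2) F d)
    (homogeneousSubmodule_le_comap F d)

end SL2

end SL2Plethysm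

/-!
All the representations involved are spaces of polynomials in the homogeneous coordinates of several
points of the projective line. A tensor in `(Sym^d E)^{⊗ n}` is a polynomial in `n` points that is
homogeneous of degree `d` in each of them, place permutations permute the points, and so
`Sym_n Sym^d E` is the space of such polynomials that are symmetric in the points
(`IsBinaryModel.lowerSym`; the natural representation is the case `d = 1`). A tensor product
corresponds to polynomials in the disjoint union of the two sets of points (`IsModel.tprod`).

In this language each isomorphism is a specialisation of points, which is visibly equivariant:

* the point of `Sym^K E` is set equal to one of the `K + 1` points of `Sym_{K+1} Sym^d E`;
* the `K` points of `Sym_K E` are set equal to all but one of the `K + 1` points of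
  `Sym_{K+1} Sym^d E`;
* `K` of the `d + K` points of `Sym_{d+K} E` are set equal to the `K` points of `Sym_K Sym^d E`.

The degrees of points that collide add up, so the specialised polynomial lies in the other
representation. Both sides have the same dimension because `Sym_n V` has dimension
`(dim V).multichoose n` (`finrank_lowerSymSubmodule`), so only injectivity is at stake. This follows
over every field from one fact (`eq_zero_of_relabel_update_eq_zero`): a form of degree `d` in a
point that vanishes whenever this point collides with one of `d + 1` others is zero, by the
homogeneous Vandermonde determinant in the generic coordinates of those points. The first
specialisation is settled by this fact and symmetry; in the other two the
collided points are separated again one at a time, and the fact shows at each step that the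
polynomial still vanishes.
-/

namespace SL2Plethysm

open MvPolynomial

/-! ### Polynomials in the coordinates of a set of points -/

/-- Relabelling of points. `MvPolynomial (α × Fin 2) F` is the polynomial ring in the two
homogeneous coordinates `X (a, 0)`, `X (a, 1)` of each point `a : α`, and `relabel F f` is the
algebra map sending both coordinates of the point `a` to those of the point `f a`. -/
noncomputable def relabel (F : Type*) [Field F] {α β : Type*} (f : α → β) :
    MvPolynomial (α × Fin 2) F →ₐ[F] MvPolynomial (β × Fin 2) F :=
  rename (Prod.map f id)

/-- The copy at the point `a` of a polynomial in two variables. -/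
noncomputable def place (F : Type*) [Field F] {α : Type*} (a : α) :
    MvPolynomial (Fin 2) F →ₐ[F] MvPolynomial (α × Fin 2) F :=
  rename (Prod.mk a)

/-- The simultaneous linear substitution by `g` in the coordinates of all points. -/
noncomputable def subst {F : Type*} [Field F] {α : Type*}
    (g : Matrix.SpecialLinearGroup (Fin 2) F) :
    MvPolynomial (α × Fin 2) F →ₐ[F] MvPolynomial (α × Fin 2) F :=
  aeval fun p => ∑ i, C (g.1 i p.2) * X (p.1, i)

section Relabel

variable {F : Type*} [Field F] {α β γ : Type*}

theorem relabel_relabel (f : α → β) (g : β → γ) (h : MvPolynomial (α × Fin 2) F) :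
    relabel F g (relabel F f h) = relabel F (g ∘ f) h := by
  rw [relabel, relabel, relabel, rename_rename, Prod.map_comp_map, Function.comp_id]

theorem relabel_id (h : MvPolynomial (α × Fin 2) F) : relabel F id h = h := by
  rw [relabel, Prod.map_id, rename_id_apply]

theorem relabel_place (f : α → β) (a : α) (p : MvPolynomial (Fin 2) F) :
    relabel F f (place F a p) = place F (f a) p := by
  rw [relabel, place, place, rename_rename]; rfl

theorem relabel_injective {f : α → β} (hf : Function.Injective f) :
    Function.Injective (relabel F f) :=
  rename_injective _ (hf.prodMap Function.injective_id)

theorem subst_relabel (g : Matrix.SpecialLinearGroup (Fin 2) F) (f : α → β)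
    (h : MvPolynomial (α × Fin 2) F) : subst g (relabel F f h) = relabel F f (subst g h) := by
  suffices (subst g).comp (relabel F f) = (relabel F f).comp (subst g) from
    DFunLike.congr_fun this h
  apply algHom_ext
  intro p
  simp [subst, relabel]

theorem subst_place (g : Matrix.SpecialLinearGroup (Fin 2) F) (a : α)
    (p : MvPolynomial (Fin 2) F) : subst g (place F a p) = place F a (polySubst g p) := by
  suffices (subst g).comp (place F a) = (place F a).comp (polySubst g) from
    DFunLike.congr_fun this p
  apply algHom_ext
  intro p
  simp [subst, place, polySubst]

end Relabel

/-! ### Degrees in each point -/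

section Multidegree

/-- The weight recording the degree in each point separately. -/
noncomputable def pointWeight (α : Type*) (p : α × Fin 2) : α →₀ ℕ := Finsupp.single p.1 1

variable {F : Type*} [Field F] {α β γ : Type*}

theorem weight_pointWeight_apply (s : α × Fin 2 →₀ ℕ) (a : α) :
    Finsupp.weight (pointWeight α) s a = s (a, 0) + s (a, 1) := by
  classical
  induction s using Finsupp.induction_linear with
  | zero => simp
  | add s t hs ht => simp only [map_add, Finsupp.add_apply, hs, ht]; ring
  | single p n =>
    obtain ⟨b, j⟩ := p
    by_cases hb : b = a
    · subst hb
      fin_cases j <;> simp [Finsupp.weight_single, pointWeight]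
    · simp [Finsupp.weight_single, pointWeight, hb]

theorem isWeightedHomogeneous_rename {σ τ M N : Type*} [AddCommMonoid M] [AddCommMonoid N]
    {w : σ → M} {w' : τ → N} (f : σ → τ) (L : M →+ N) (hL : ∀ i, w' (f i) = L (w i))
    {h : MvPolynomial σ F} {δ : M} (hh : IsWeightedHomogeneous w h δ) :
    IsWeightedHomogeneous w' (rename f h) (L δ) := by
  intro s hs
  obtain ⟨u, rfl, hu⟩ := coeff_rename_ne_zero _ _ _ hs
  rw [← hh hu, Finsupp.weight_apply, Finsupp.weight_apply, Finsupp.sum_mapDomain_index (by simp)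
    (by intros; rw [add_smul]), Finsupp.sum, Finsupp.sum, map_sum]
  exact Finset.sum_congr rfl fun i _ => by rw [hL, map_nsmul]

theorem isWeightedHomogeneous_relabel (f : α → β) {h : MvPolynomial (α × Fin 2) F} {δ : α →₀ ℕ}
    (hh : IsWeightedHomogeneous (pointWeight α) h δ) :
    IsWeightedHomogeneous (pointWeight β) (relabel F f h) (δ.mapDomain f) :=
  isWeightedHomogeneous_rename _ (Finsupp.mapDomain.addMonoidHom f)
    (fun p => by simp [pointWeight]) hh

theorem isWeightedHomogeneous_place (a : α) {p : MvPolynomial (Fin 2) F} {d : ℕ}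
    (hp : p.IsHomogeneous d) :
    IsWeightedHomogeneous (pointWeight α) (place F a p) (Finsupp.single a d) :=
  isWeightedHomogeneous_rename (w := 1) _ (Finsupp.singleAddHom a)
    (fun p => by simp [pointWeight]) hp

end Multidegree

/-! ### Symmetric forms and models of representations -/

/-- The polynomials that are homogeneous of degree `d` in each point of `α` and invariant under
all permutations of the points. -/
noncomputable def symForms (F : Type*) [Field F] (α : Type*) [Finite α] (d : ℕ) :
    Submodule F (MvPolynomial (α × Fin 2) F) where
  carrier := {h | IsWeightedHomogeneous (pointWeight α) h
    (Finsupp.equivFunOnFinite.symm fun _ => d) ∧ ∀ σ : Equiv.Perm α, relabel F σ h = h}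
  add_mem' hp hq := ⟨hp.1.add hq.1, fun σ => by rw [map_add, hp.2, hq.2]⟩
  zero_mem' := ⟨isWeightedHomogeneous_zero _ _ _, fun σ => map_zero _⟩
  smul_mem' c h hh := ⟨(weightedHomogeneousSubmodule F _ _).smul_mem c hh.1,
    fun σ => by rw [map_smul, hh.2]⟩

/-- The polynomials that are homogeneous of degree `e` in each point of `α` and of degree `d` in
each point of `β`, and invariant under permutations within `α` and within `β`. -/
noncomputable def bisymForms (F : Type*) [Field F] (α β : Type*) [Finite α] [Finite β] (e d : ℕ) :
    Submodule F (MvPolynomial ((α ⊕ β) × Fin 2) F) where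
  carrier := {h | IsWeightedHomogeneous (pointWeight (α ⊕ β)) h
    (Finsupp.equivFunOnFinite.symm (Sum.elim (fun _ => e) fun _ => d)) ∧
    ∀ (σ : Equiv.Perm α) (τ : Equiv.Perm β), relabel F (Sum.map σ τ) h = h}
  add_mem' hp hq := ⟨hp.1.add hq.1, fun σ τ => by rw [map_add, hp.2, hq.2]⟩
  zero_mem' := ⟨isWeightedHomogeneous_zero _ _ _, fun σ τ => map_zero _⟩
  smul_mem' c h hh := ⟨(weightedHomogeneousSubmodule F _ _).smul_mem c hh.1,
    fun σ τ => by rw [map_smul, hh.2]⟩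

/-- A model of a representation of `SL₂(F)` inside the polynomials in the coordinates of the
points of `α`: an injective equivariant map with range `S`. -/
structure IsModel {F V : Type*} [Field F] [AddCommGroup V] [Module F V] {α : Type*}
    (ρ : Representation F (Matrix.SpecialLinearGroup (Fin 2) F) V)
    (φ : V →ₗ[F] MvPolynomial (α × Fin 2) F) (S : Submodule F (MvPolynomial (α × Fin 2) F)) :
    Prop where
  injective : Function.Injective φ
  range_eq : LinearMap.range φ = S
  map_smul : ∀ g v, φ (ρ g v) = subst g (φ v)

/-! ### Binary forms vanishing at many points -/

section BinaryForms

/-- The exponent of the monomial `X ^ k * Y ^ (d - k)`. -/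
noncomputable def binaryExponent (d : ℕ) (k : Fin (d + 1)) : Fin 2 →₀ ℕ :=
  Finsupp.single 0 k.1 + Finsupp.single 1 k.rev.1

theorem binaryExponent_injective (d : ℕ) : Function.Injective (binaryExponent d) := by
  intro k l h
  have := DFunLike.congr_fun h 0
  exact Fin.ext (by simpa [binaryExponent] using this)

theorem degree_binaryExponent (d : ℕ) (k : Fin (d + 1)) : (binaryExponent d k).degree = d := by
  simp only [binaryExponent, map_add, Finsupp.degree_single, Fin.val_rev]
  omega

theorem exists_binaryExponent_eq {d : ℕ} {m : Fin 2 →₀ ℕ} (hm : m.degree = d) :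
    ∃ k, binaryExponent d k = m := by
  have h : m 0 + m 1 = d := by rw [← hm, Finsupp.degree_eq_sum, Fin.sum_univ_two]
  refine ⟨⟨m 0, by omega⟩, ?_⟩
  ext i
  fin_cases i
  · simp [binaryExponent]
  · simp [binaryExponent, Fin.val_rev]; omega

variable {R : Type*} [CommRing R]

theorem eq_sum_monomial_binaryExponent {p : MvPolynomial (Fin 2) R} {d : ℕ}
    (hp : p.IsHomogeneous d) :
    p = ∑ k, monomial (binaryExponent d k) (coeff (binaryExponent d k) p) := by
  classical
  ext m
  rw [coeff_sum]
  simp only [coeff_monomial]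
  by_cases hm : m.degree = d
  · obtain ⟨k, rfl⟩ := exists_binaryExponent_eq hm
    simp [(binaryExponent_injective d).eq_iff]
  · rw [hp.coeff_eq_zero hm]
    symm
    refine Finset.sum_eq_zero fun k _ => if_neg ?_
    rintro rfl
    exact hm (degree_binaryExponent d k)

/-- A binary form of degree `d` over a domain that vanishes at `d + 1` pairwise non-proportional
points is zero. -/
theorem eq_zero_of_eval_binary_eq_zero [IsDomain R]
    {p : MvPolynomial (Fin 2) R} {d : ℕ} (hp : p.IsHomogeneous d) (v w : Fin (d + 1) → R)
    (hvw : ∀ i j, i ≠ j → v j * w i - v i * w j ≠ 0) (h : ∀ i, eval ![v i, w i] p = 0) :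
    p = 0 := by
  have hdet : (Matrix.projVandermonde v w).det ≠ 0 := by
    rw [Matrix.det_projVandermonde]
    refine Finset.prod_ne_zero_iff.2 fun i _ => Finset.prod_ne_zero_iff.2 fun j hj => hvw i j ?_
    exact (Finset.mem_Ioi.1 hj).ne
  have hc := Matrix.eq_zero_of_mulVec_eq_zero hdet
    (v := fun k => coeff (binaryExponent d k) p) (by
      ext i
      rw [Pi.zero_apply, ← h i]
      conv_rhs => rw [eq_sum_monomial_binaryExponent hp]
      simp only [Matrix.mulVec, dotProduct, map_sum, eval_monomial, Matrix.projVandermonde_apply]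
      refine Finset.sum_congr rfl fun k _ => ?_
      rw [Finsupp.prod_fintype _ _ (by simp), Fin.prod_univ_two]
      simp [binaryExponent, mul_comm])
  rw [eq_sum_monomial_binaryExponent hp]
  exact Finset.sum_eq_zero fun k _ => by rw [congrFun hc k]; simp

end BinaryForms

/-! ### Collisions of points are injective on symmetric forms -/

section Vanishing

variable {F : Type*} [Field F] {γ : Type*}

/-- A polynomial that is homogeneous of degree `d` in the point `a` and that vanishes whenever
`a` is specialised to any of `d + 1` distinct points is zero. -/
theorem eq_zero_of_relabel_update_eq_zero [DecidableEq γ]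
    {h : MvPolynomial (γ × Fin 2) F} {δ : γ →₀ ℕ}
    (hh : IsWeightedHomogeneous (pointWeight γ) h δ) {a : γ} {d : ℕ} (hd : δ a = d)
    (b : Fin (d + 1) → γ)
    (hb : Function.Injective b)
    (hz : ∀ i, relabel F (Function.update id a (b i)) h = 0) : h = 0 := by
  -- `θ` replaces the coordinates of `a` by new variables, so that `θ h` is a binary form over the
  -- polynomial ring, and evaluating it at the point `c` specialises `a` to `c`.
  let θ : MvPolynomial (γ × Fin 2) F →ₐ[F] MvPolynomial (Fin 2) (MvPolynomial (γ × Fin 2) F) :=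
    aeval fun p => if p.1 = a then X p.2 else C (X p)
  have hθ : ∀ c : γ, (((aeval ![X (c, 0), X (c, 1)] :
      MvPolynomial (Fin 2) (MvPolynomial (γ × Fin 2) F) →ₐ[_] _).restrictScalars F).comp θ) =
        relabel F (Function.update id a c) := by
    intro c
    apply algHom_ext
    rintro ⟨e, j⟩
    by_cases he : e = a
    · subst he
      fin_cases j <;> simp [θ, relabel]
    · simp [θ, relabel, he]
  have hhom : (θ h).IsHomogeneous d := by
    subst hd
    rw [h.as_sum, map_sum]
    refine IsHomogeneous.sum _ _ _ fun s hs => ?_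
    rw [← hh (mem_support_iff.1 hs), Finsupp.weight_apply, Finsupp.sum, Finsupp.finsetSum_apply,
      aeval_monomial, MvPolynomial.algebraMap_apply, ← zero_add (Finset.sum _ _)]
    refine (isHomogeneous_C _ _).mul (IsHomogeneous.prod _ _ _ fun p _ => ?_)
    by_cases hp : p.1 = a
    · simpa [pointWeight, hp] using (isHomogeneous_X _ p.2).pow (s p)
    · simpa [pointWeight, hp] using (isHomogeneous_C _ _).pow (s p)
  have h0 : θ h = 0 := by
    refine eq_zero_of_eval_binary_eq_zero hhom (fun i => X (b i, 0))
      (fun i => X (b i, 1)) ?_ ?_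
    · intro i j hij he
      rw [sub_eq_zero, X, X, X, X, monomial_mul, monomial_mul, monomial_left_inj (by simp)] at he
      have := DFunLike.congr_fun he (b j, 0)
      simp [hb.eq_iff, hij] at this
    · intro i
      have := DFunLike.congr_fun (hθ (b i)) h
      rw [hz i] at this
      simpa [aeval_eq_eval] using this
  have := DFunLike.congr_fun (hθ a) h
  rw [show Function.update id a a = id from Function.update_eq_self a id, relabel_id,
    AlgHom.comp_apply, h0, map_zero] at this
  exact this.symm

theorem relabel_eq_zero_of_comp_eq {α β : Type*} {h : MvPolynomial (α × Fin 2) F} {f : α → β}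
    (h0 : relabel F f h = 0) (q : β → γ) {r : α → γ} (hr : ∀ a, q (f a) = r a) :
    relabel F r h = 0 := by
  obtain rfl : q ∘ f = r := funext hr
  rw [← relabel_relabel, h0, map_zero]

theorem mapDomain_apply_of_forall_eq {α β : Type*} (f : α → β) (δ : α →₀ ℕ) {a : α} {b : β}
    (hab : f a = b) (h : ∀ x, f x = b → x = a) : δ.mapDomain f b = δ a := by
  classical
  subst hab
  rw [Finsupp.mapDomain, Finsupp.sum_apply, Finsupp.sum, Finset.sum_eq_single a]
  · simp
  · intro x _ hx
    exact Finsupp.single_eq_of_ne fun he => hx (h x he.symm)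
  · intro ha
    simpa using ha

/-- The point of `Sym^K E` collides with one of the
`K + 1` points of `Sym_{K+1} Sym^d E`. -/
def collideOuter (K : ℕ) : Unit ⊕ Fin (K + 1) → Unit ⊕ Fin K :=
  Sum.elim Sum.inl (Fin.cons (Sum.inl ()) Sum.inr)

/-- The `K` points of `Sym_K E` collide with all but
one of the `K + 1` points of `Sym_{K+1} Sym^d E`; the remaining one becomes the point of
`Sym^d E`. -/
def collideAllButOne (K : ℕ) : Fin K ⊕ Fin (K + 1) → Unit ⊕ Fin K :=
  Sum.elim Sum.inr (Fin.cons (Sum.inl ()) Sum.inr)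

/-- `K` of the `d + K` points of `Sym_{d+K} E` collide
with the points of `Sym_K Sym^d E`. -/
def collideAll (d K : ℕ) : Fin (d + K) ⊕ Fin K → Fin d ⊕ Fin K :=
  Sum.elim finSumFinEquiv.symm Sum.inr

/-- By symmetry in the `K + 1` inner points, the form of degree `K` in the outer point vanishes when
the outer point is any one of them. -/
theorem eq_zero_of_relabel_collideOuter {K d : ℕ}
    {h : MvPolynomial ((Unit ⊕ Fin (K + 1)) × Fin 2) F}
    (hh : h ∈ bisymForms F Unit (Fin (K + 1)) K d) (h0 : relabel F (collideOuter K) h = 0) :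
    h = 0 := by
  refine eq_zero_of_relabel_update_eq_zero hh.1 (a := Sum.inl ()) (d := K) rfl Sum.inr
    Sum.inr_injective
    fun c => ?_
  rw [← hh.2 1 (Equiv.swap 0 c), relabel_relabel]
  refine relabel_eq_zero_of_comp_eq h0
    (Sum.elim (fun _ => Sum.inr c) fun i => Sum.inr (Equiv.swap 0 c i.succ)) ?_
  rintro (_ | x)
  · simp [collideOuter]
  · refine Fin.cases ?_ (fun i => ?_) x <;> simp [collideOuter]

/-- The `K` outer points are set free one at a time: a form of degree `1` in a free outer point that
vanishes when this point collides with either of two inner points vanishes. -/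
theorem eq_zero_of_relabel_collideAllButOne {K d : ℕ}
    {h : MvPolynomial ((Fin K ⊕ Fin (K + 1)) × Fin 2) F}
    (hh : h ∈ bisymForms F (Fin K) (Fin (K + 1)) 1 d)
    (h0 : relabel F (collideAllButOne K) h = 0) : h = 0 := by
  -- `B` is the set of free outer points; the others sit at the inner points `v i`.
  suffices H : ∀ (B : Finset (Fin K)) (v : Fin K → Fin (K + 1)), Function.Injective v →
      relabel F (Sum.elim (fun i => if i ∈ B then Sum.inl i else Sum.inr (v i)) Sum.inr :
        _ → Fin K ⊕ Fin (K + 1)) h = 0 by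
    have := H Finset.univ Fin.succ (Fin.succ_injective K)
    simp only [Finset.mem_univ, if_true] at this
    rwa [show (Sum.elim (fun i => Sum.inl i) Sum.inr : Fin K ⊕ Fin (K + 1) → _) = id from
      Sum.elim_inl_inr, relabel_id] at this
  intro B
  induction B using Finset.induction_on with
  | empty =>
    intro v hv
    obtain ⟨w, hw⟩ : ∃ w, w ∉ Set.range v := by
      by_contra! hs
      simpa using Fintype.card_le_of_surjective v hs
    let τ : Equiv.Perm (Fin (K + 1)) := Equiv.ofBijective (Fin.cons w v)
      (Finite.injective_iff_bijective.1 (Fin.cons_injective_iff.2 ⟨hw, hv⟩))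
    rw [← hh.2 1 τ, relabel_relabel]
    refine relabel_eq_zero_of_comp_eq h0 (Sum.elim (fun _ => Sum.inr w) fun i => Sum.inr (v i)) ?_
    rintro (i | x)
    · simp [collideAllButOne]
    · refine Fin.cases ?_ (fun i => ?_) x <;> simp [collideAllButOne, τ]
  | insert i B hi ih =>
    intro v hv
    obtain ⟨w, hw⟩ : ∃ w, w ∉ Set.range v := by
      by_contra! hs
      simpa using Fintype.card_le_of_surjective v hs
    have hcw : ∀ x, v x ≠ w := fun x hx => hw ⟨x, hx⟩
    refine eq_zero_of_relabel_update_eq_zero (isWeightedHomogeneous_relabel _ hh.1)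
      (a := Sum.inl i) (d := 1) ?_ ![Sum.inr (v i), Sum.inr w] ?_ fun j => ?_
    · refine mapDomain_apply_of_forall_eq _ _ (a := Sum.inl i) (by simp) ?_
      rintro (x | x) hx
      · by_cases hxB : x ∈ insert i B
        · simpa only [Sum.elim_inl, if_pos hxB] using hx
        · simp only [Sum.elim_inl, if_neg hxB, reduceCtorEq] at hx
      · simp at hx
    · intro a b
      fin_cases a <;> fin_cases b <;> simp [hcw, (hcw _).symm]
    · have step : ∀ c, Function.Injective (Function.update v i c) →
          relabel F (Function.update id (Sum.inl i) (Sum.inr c) : _ → Fin K ⊕ Fin (K + 1))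
            (relabel F (Sum.elim (fun j => if j ∈ insert i B then Sum.inl j else Sum.inr (v j))
              Sum.inr) h) = 0 := by
        intro c hc
        rw [relabel_relabel]
        refine relabel_eq_zero_of_comp_eq (ih _ hc) id ?_
        rintro (x | x)
        · by_cases hx : x = i
          · subst hx; simp [hi]
          · by_cases hxB : x ∈ B <;> simp [hx, hxB]
        · simp
      fin_cases j
      · exact step (v i) (by rwa [Function.update_eq_self])
      · refine step w fun x y hxy => ?_
        by_cases hx : x = i <;> by_cases hy : y = i <;>
          simp_all [(hcw _).symm, hv.eq_iff]

/-- The `K` outer points that sit at the inner points are set free one at a time. Once the outer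
point `inr i` is free, the form has degree `d` in the inner point `i` and vanishes when `i` collides
with `inr i`, hence, by symmetry in the outer points, with any of `d + 1` free outer points. -/
theorem eq_zero_of_relabel_elim_id {d K : ℕ} {δ : (Fin d ⊕ Fin K) ⊕ Fin K →₀ ℕ}
    {h : MvPolynomial (((Fin d ⊕ Fin K) ⊕ Fin K) × Fin 2) F}
    (hh : IsWeightedHomogeneous (pointWeight _) h δ) (hδ : ∀ i, δ (Sum.inr i) = d)
    (hsymm : ∀ σ : Equiv.Perm (Fin d ⊕ Fin K), relabel F (Sum.map σ id) h = h)
    (h0 : relabel F (Sum.elim id Sum.inr) h = 0) : h = 0 := by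
  -- `B` is the set of outer points `inr i` that have been set free.
  let u (B : Finset (Fin K)) : (Fin d ⊕ Fin K) ⊕ Fin K → (Fin d ⊕ Fin K) ⊕ Fin K :=
    Sum.elim (Sum.elim (fun j => Sum.inl (Sum.inl j))
      fun i => if i ∈ B then Sum.inl (Sum.inr i) else Sum.inr i) Sum.inr
  suffices H : ∀ B, relabel F (u B) h = 0 by
    rw [← relabel_id h, ← H Finset.univ]
    congr 2
    ext ((_ | _) | _) <;> simp [u]
  intro B
  induction B using Finset.induction_on with
  | empty =>
    refine relabel_eq_zero_of_comp_eq h0 (Sum.elim (fun j => Sum.inl (Sum.inl j)) Sum.inr) ?_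
    rintro ((_ | _) | _) <;> simp [u]
  | insert i B hi ih =>
    have hlast : relabel F (Function.update id (Sum.inr i) (Sum.inl (Sum.inr i)))
        (relabel F (u (insert i B)) h) = 0 := by
      rw [relabel_relabel]
      refine relabel_eq_zero_of_comp_eq ih
        (Function.update id (Sum.inr i) (Sum.inl (Sum.inr i))) ?_
      rintro ((x | x) | x)
      · simp [u]
      · by_cases hx : x = i
        · subst hx; simp [u, hi]
        · by_cases hxB : x ∈ B <;> simp [u, hx, hxB]
      · simp [u]
    refine eq_zero_of_relabel_update_eq_zero (isWeightedHomogeneous_relabel _ hh)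
      (a := Sum.inr i) (d := d) ?_
      (Fin.cons (Sum.inl (Sum.inr i)) fun j => Sum.inl (Sum.inl j)) ?_ fun j => ?_
    · refine (mapDomain_apply_of_forall_eq _ _ (by simp [u]) ?_).trans (hδ i)
      rintro ((x | x) | x) hx
      · simp [u] at hx
      · by_cases hxB : x ∈ insert i B
        · simp only [u, Sum.elim_inl, Sum.elim_inr, if_pos hxB, reduceCtorEq] at hx
        · have : x = i := by
            simpa only [u, Sum.elim_inl, Sum.elim_inr, if_neg hxB, Sum.inr.injEq] using hx
          exact absurd (this ▸ Finset.mem_insert_self i B) hxB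
      · simpa [u] using hx
    · refine Fin.cons_injective_iff.2 ⟨by simp, fun a b hab => by simpa using hab⟩
    · refine Fin.cases hlast (fun j => ?_) j
      -- Exchanging the free points `inl j` and `inr i` reduces to the previous case.
      let σ : Equiv.Perm (Fin d ⊕ Fin K) := Equiv.swap (Sum.inl j) (Sum.inr i)
      rw [← hsymm σ]
      rw [relabel_relabel] at hlast ⊢
      rw [relabel_relabel]
      refine relabel_eq_zero_of_comp_eq hlast (Sum.map σ id) ?_
      rintro ((x | x) | x)
      · by_cases hx : x = j
        · subst hx; simp [u, σ]
        · have : σ (Sum.inl x) = Sum.inl x := Equiv.swap_apply_of_ne_of_ne (by simpa) (by simp)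
          simp [u, this]
      · by_cases hx : x = i
        · subst hx; simp [u, σ]
        · have : σ (Sum.inr x) = Sum.inr x := Equiv.swap_apply_of_ne_of_ne (by simp) (by simpa)
          by_cases hxB : x ∈ B <;> simp [u, this, hx, hxB]
      · by_cases hx : x = i
        · subst hx; simp [u, σ]
        · simp [u, hx]

theorem eq_zero_of_relabel_collideAll {K d : ℕ}
    {h : MvPolynomial ((Fin (d + K) ⊕ Fin K) × Fin 2) F}
    (hh : h ∈ bisymForms F (Fin (d + K)) (Fin K) 1 d)
    (h0 : relabel F (collideAll d K) h = 0) : h = 0 := by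
  let e : Fin d ⊕ Fin K ≃ Fin (d + K) := finSumFinEquiv
  refine relabel_injective (f := Sum.map e.symm (id : Fin K → Fin K))
    (e.symm.injective.sumMap Function.injective_id) ?_
  rw [map_zero]
  refine eq_zero_of_relabel_elim_id (isWeightedHomogeneous_relabel _ hh.1) (fun i => ?_)
    (fun σ => ?_) ?_
  · refine (mapDomain_apply_of_forall_eq _ _ (a := Sum.inr i) rfl ?_).trans rfl
    rintro (x | x) hx
    · simp at hx
    · simpa using hx
  · conv_rhs => rw [← hh.2 ((e.symm.trans σ).trans e) 1]
    rw [relabel_relabel, relabel_relabel]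
    congr 2
    ext (x | x) <;> simp
  · rw [relabel_relabel]
    refine relabel_eq_zero_of_comp_eq h0 id ?_
    rintro (x | x) <;> simp [collideAll, e]

end Vanishing

/-! ### The image of a collision -/

section Collide

variable {F : Type*} [Field F]

theorem mapDomain_apply_eq_sum {α β : Type*} [Fintype α] [DecidableEq β] (f : α → β) (δ : α →₀ ℕ)
    (b : β) : δ.mapDomain f b = ∑ a, if f a = b then δ a else 0 := by
  rw [Finsupp.mapDomain, Finsupp.sum_apply, Finsupp.sum_fintype _ _ (by simp)]
  exact Finset.sum_congr rfl fun a _ => Finsupp.single_apply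

/-- A map of points carries doubly symmetric forms to doubly symmetric forms if it adds up the
degrees correctly and every pair of permutations of the target lifts to the source. -/
theorem relabel_mem_bisymForms {α β α' β' : Type*} [Fintype α] [Fintype β] [Fintype α']
    [Fintype β'] [DecidableEq α'] [DecidableEq β']
    {e d e' d' : ℕ} (f : α ⊕ β → α' ⊕ β')
    (hdeg : ∀ b, ∑ a, (if f a = b then Sum.elim (fun _ => e) (fun _ => d) a else 0) =
      Sum.elim (fun _ => e') (fun _ => d') b)
    (hperm : ∀ (σ : Equiv.Perm α') (τ : Equiv.Perm β'), ∃ (σ' : Equiv.Perm α) (τ' : Equiv.Perm β),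
      ∀ a, Sum.map σ τ (f a) = f (Sum.map σ' τ' a))
    {h : MvPolynomial ((α ⊕ β) × Fin 2) F} (hh : h ∈ bisymForms F α β e d) :
    relabel F f h ∈ bisymForms F α' β' e' d' := by
  refine ⟨?_, fun σ τ => ?_⟩
  · have : Finsupp.mapDomain f (Finsupp.equivFunOnFinite.symm
        (Sum.elim (fun _ => e) fun _ => d)) =
        Finsupp.equivFunOnFinite.symm (Sum.elim (fun _ => e') fun _ => d') := by
      ext b
      rw [mapDomain_apply_eq_sum]
      exact hdeg b
    rw [← this]
    exact isWeightedHomogeneous_relabel f hh.1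
  · obtain ⟨σ', τ', hστ⟩ := hperm σ τ
    conv_rhs => rw [← hh.2 σ' τ']
    rw [relabel_relabel, relabel_relabel]
    congr 2
    exact funext hστ

theorem relabel_collideOuter_mem {K d : ℕ} {h : MvPolynomial ((Unit ⊕ Fin (K + 1)) × Fin 2) F}
    (hh : h ∈ bisymForms F Unit (Fin (K + 1)) K d) :
    relabel F (collideOuter K) h ∈ bisymForms F Unit (Fin K) (d + K) d := by
  refine relabel_mem_bisymForms _ (fun b => ?_)
    (fun σ τ => ⟨1, Equiv.Perm.decomposeFin.symm (0, τ), ?_⟩) hh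
  · rcases b with _ | b
    · simp [collideOuter, Fin.sum_univ_succ, add_comm]
    · simp [collideOuter, Fin.sum_univ_succ]
  · rintro (_ | x)
    · simp [collideOuter]
    · refine Fin.cases ?_ (fun i => ?_) x <;> simp [collideOuter]

theorem relabel_collideAllButOne_mem {K d : ℕ}
    {h : MvPolynomial ((Fin K ⊕ Fin (K + 1)) × Fin 2) F}
    (hh : h ∈ bisymForms F (Fin K) (Fin (K + 1)) 1 d) :
    relabel F (collideAllButOne K) h ∈ bisymForms F Unit (Fin K) d (d + 1) := by
  refine relabel_mem_bisymForms _ (fun b => ?_)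
    (fun σ τ => ⟨τ, Equiv.Perm.decomposeFin.symm (0, τ), ?_⟩) hh
  · rcases b with _ | b
    · simp [collideAllButOne, Fin.sum_univ_succ]
    · simp [collideAllButOne, Fin.sum_univ_succ, add_comm]
  · rintro (x | x)
    · simp [collideAllButOne]
    · refine Fin.cases ?_ (fun i => ?_) x <;> simp [collideAllButOne]

theorem relabel_collideAll_mem {K d : ℕ}
    {h : MvPolynomial ((Fin (d + K) ⊕ Fin K) × Fin 2) F}
    (hh : h ∈ bisymForms F (Fin (d + K)) (Fin K) 1 d) :
    relabel F (collideAll d K) h ∈ bisymForms F (Fin d) (Fin K) 1 (d + 1) := by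
  refine relabel_mem_bisymForms _ (fun b => ?_)
    (fun σ τ => ⟨finSumFinEquiv.symm.trans ((σ.sumCongr τ).trans finSumFinEquiv), τ, ?_⟩) hh
  · rcases b with b | b
    · simp [collideAll, Equiv.symm_apply_eq]
    · simp [collideAll, Equiv.symm_apply_eq, add_comm]
  · rintro (x | x) <;> simp [collideAll]

end Collide

/-! ### Models of tensor products -/

section Tensor

/-- A tensor all of whose coordinate slices lie in `P` and in `Q` comes from `P ⊗ Q`. -/
theorem mem_range_mapIncl_of_slices {k A B ι κ : Type*} [Field k] [AddCommGroup A] [Module k A]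
    [AddCommGroup B] [Module k B] (b : Module.Basis ι k A) (c : Module.Basis κ k B)
    (P : Submodule k A) (Q : Submodule k B) (t : A ⊗[k] B)
    (hQ : ∀ i, TensorProduct.lid k B ((b.coord i).rTensor B t) ∈ Q)
    (hP : ∀ j, TensorProduct.rid k A ((c.coord j).lTensor A t) ∈ P) :
    t ∈ LinearMap.range (TensorProduct.mapIncl P Q) := by
  classical
  obtain ⟨π, hπ⟩ := P.subtype.exists_leftInverse_of_injective P.ker_subtype
  obtain ⟨π', hπ'⟩ := Q.subtype.exists_leftInverse_of_injective Q.ker_subtype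
  have hQt : (Q.subtype ∘ₗ π').lTensor A t = t := by
    apply (TensorProduct.equivFinsuppOfBasisLeft b).injective
    ext i
    rw [TensorProduct.equivFinsuppOfBasisLeft_apply, TensorProduct.equivFinsuppOfBasisLeft_apply]
    have h1 : ∀ s : A ⊗[k] B, TensorProduct.lid k B ((b.coord i).rTensor B
        ((Q.subtype ∘ₗ π').lTensor A s)) =
        Q.subtype (π' (TensorProduct.lid k B ((b.coord i).rTensor B s))) := by
      intro s
      induction s with
      | zero => simp
      | add s t hs ht => simp only [map_add, hs, ht]
      | tmul x y => simp
    rw [h1]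
    exact congrArg Subtype.val (LinearMap.congr_fun hπ' ⟨_, hQ i⟩)
  have hPt : (P.subtype ∘ₗ π).rTensor B t = t := by
    apply (TensorProduct.equivFinsuppOfBasisRight c).injective
    ext j
    rw [TensorProduct.equivFinsuppOfBasisRight_apply, TensorProduct.equivFinsuppOfBasisRight_apply]
    have h1 : ∀ s : A ⊗[k] B, TensorProduct.rid k A ((c.coord j).lTensor A
        ((P.subtype ∘ₗ π).rTensor B s)) =
        P.subtype (π (TensorProduct.rid k A ((c.coord j).lTensor A s))) := by
      intro s
      induction s with
      | zero => simp
      | add s t hs ht => simp only [map_add, hs, ht]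
      | tmul x y => simp
    rw [h1]
    exact congrArg Subtype.val (LinearMap.congr_fun hπ ⟨_, hP j⟩)
  refine ⟨TensorProduct.map π π' t, ?_⟩
  rw [TensorProduct.mapIncl, ← LinearMap.comp_apply, ← TensorProduct.map_comp,
    ← LinearMap.rTensor_comp_lTensor, LinearMap.comp_apply, hQt, hPt]

variable (F : Type*) [Field F] (α β : Type*)

/-- Polynomials in the points of `α ⊕ β` as tensors. -/
noncomputable def pairEquiv : MvPolynomial (α × Fin 2) F ⊗[F] MvPolynomial (β × Fin 2) F ≃ₐ[F]
    MvPolynomial ((α ⊕ β) × Fin 2) F :=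
  (tensorEquivSum F (α × Fin 2) (β × Fin 2) F).trans
    (renameEquiv F (Equiv.sumProdDistrib α β (Fin 2)).symm)

variable {F α β}

theorem pairEquiv_tmul (p : MvPolynomial (α × Fin 2) F) (q : MvPolynomial (β × Fin 2) F) :
    pairEquiv F α β (p ⊗ₜ q) = relabel F Sum.inl p * relabel F Sum.inr q := by
  have h1 : ((pairEquiv F α β).toAlgHom.comp Algebra.TensorProduct.includeLeft) =
      relabel F (Sum.inl : α → α ⊕ β) := by
    apply algHom_ext
    rintro ⟨x, j⟩
    simp [pairEquiv, relabel]
  have h2 : ((pairEquiv F α β).toAlgHom.comp Algebra.TensorProduct.includeRight) =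
      relabel F (Sum.inr : β → α ⊕ β) := by
    apply algHom_ext
    rintro ⟨x, j⟩
    simp [pairEquiv, relabel]
  rw [← h1, ← h2, ← mul_one p, ← one_mul q, ← Algebra.TensorProduct.tmul_mul_tmul, map_mul]
  simp

theorem pairEquiv_map_relabel {α' β' : Type*} (f : α → α') (g : β → β')
    (t : MvPolynomial (α × Fin 2) F ⊗[F] MvPolynomial (β × Fin 2) F) :
    pairEquiv F α' β' (TensorProduct.map (relabel F f).toLinearMap (relabel F g).toLinearMap t) =
      relabel F (Sum.map f g) (pairEquiv F α β t) := by
  induction t with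
  | zero => simp
  | add s t hs ht => simp only [map_add, hs, ht]
  | tmul p q =>
    simp only [TensorProduct.map_tmul, AlgHom.toLinearMap_apply, pairEquiv_tmul, map_mul,
      relabel_relabel]
    rfl

theorem pairEquiv_map_subst (g : Matrix.SpecialLinearGroup (Fin 2) F)
    (t : MvPolynomial (α × Fin 2) F ⊗[F] MvPolynomial (β × Fin 2) F) :
    pairEquiv F α β (TensorProduct.map (subst g).toLinearMap (subst g).toLinearMap t) =
      subst g (pairEquiv F α β t) := by
  induction t with
  | zero => simp
  | add s t hs ht => simp only [map_add, hs, ht]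
  | tmul p q =>
    simp only [TensorProduct.map_tmul, AlgHom.toLinearMap_apply, pairEquiv_tmul, map_mul,
      subst_relabel]

/-- The exponent over `α ⊕ β` with given restrictions to `α` and to `β`. -/
noncomputable def joinExponent (m : α × Fin 2 →₀ ℕ) (n : β × Fin 2 →₀ ℕ) :
    (α ⊕ β) × Fin 2 →₀ ℕ :=
  m.mapDomain (Prod.map Sum.inl id) + n.mapDomain (Prod.map Sum.inr id)

theorem joinExponent_inl (m : α × Fin 2 →₀ ℕ) (n : β × Fin 2 →₀ ℕ) (a : α) (j : Fin 2) :
    joinExponent m n (Sum.inl a, j) = m (a, j) := by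
  rw [joinExponent, Finsupp.add_apply, Finsupp.mapDomain_of_notMem_range (f := Prod.map Sum.inr id),
    add_zero]
  · exact Finsupp.mapDomain_apply (Sum.inl_injective.prodMap Function.injective_id) m (a, j)
  · rintro ⟨x, hx⟩
    exact absurd (congrArg Prod.fst hx) (by simp)

theorem joinExponent_inr (m : α × Fin 2 →₀ ℕ) (n : β × Fin 2 →₀ ℕ) (b : β) (j : Fin 2) :
    joinExponent m n (Sum.inr b, j) = n (b, j) := by
  rw [joinExponent, Finsupp.add_apply, Finsupp.mapDomain_of_notMem_range (f := Prod.map Sum.inl id),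
    zero_add]
  · exact Finsupp.mapDomain_apply (Sum.inr_injective.prodMap Function.injective_id) n (b, j)
  · rintro ⟨x, hx⟩
    exact absurd (congrArg Prod.fst hx) (by simp)

theorem joinExponent_inj {m m' : α × Fin 2 →₀ ℕ} {n n' : β × Fin 2 →₀ ℕ} :
    joinExponent m n = joinExponent m' n' ↔ m = m' ∧ n = n' := by
  refine ⟨fun h => ⟨?_, ?_⟩, by rintro ⟨rfl, rfl⟩; rfl⟩
  · ext ⟨a, j⟩
    rw [← joinExponent_inl m n, h, joinExponent_inl]
  · ext ⟨a, j⟩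
    rw [← joinExponent_inr m n, h, joinExponent_inr]

theorem coeff_pairEquiv (m : α × Fin 2 →₀ ℕ) (n : β × Fin 2 →₀ ℕ)
    (t : MvPolynomial (α × Fin 2) F ⊗[F] MvPolynomial (β × Fin 2) F) :
    coeff (joinExponent m n) (pairEquiv F α β t) =
      LinearMap.mul' F F (TensorProduct.map (lcoeff F m) (lcoeff F n) t) := by
  classical
  suffices h : lcoeff F (joinExponent m n) ∘ₗ (pairEquiv F α β).toLinearMap =
      LinearMap.mul' F F ∘ₗ TensorProduct.map (lcoeff F m) (lcoeff F n) from
    LinearMap.congr_fun h t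
  refine ((basisMonomials _ F).tensorProduct (basisMonomials _ F)).ext fun ⟨m', n'⟩ => ?_
  have h1 : pairEquiv F α β (monomial m' 1 ⊗ₜ monomial n' 1) = monomial (joinExponent m' n') 1 := by
    rw [pairEquiv_tmul, relabel, relabel, rename_monomial, rename_monomial, monomial_mul, one_mul,
      joinExponent]
  simp only [Module.Basis.tensorProduct_apply, coe_basisMonomials, LinearMap.comp_apply,
    AlgEquiv.toLinearMap_apply, h1, TensorProduct.map_tmul, lcoeff_apply, LinearMap.mul'_apply,
    coeff_monomial, joinExponent_inj]
  split_ifs <;> simp_all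

/-- The product in the points of `α ⊕ β` of a polynomial in the points of `α` and one in the
points of `β`. -/
noncomputable def pairMap {A B : Type*} [AddCommGroup A] [Module F A] [AddCommGroup B] [Module F B]
    (φ : A →ₗ[F] MvPolynomial (α × Fin 2) F) (χ : B →ₗ[F] MvPolynomial (β × Fin 2) F) :
    A ⊗[F] B →ₗ[F] MvPolynomial ((α ⊕ β) × Fin 2) F :=
  (pairEquiv F α β).toLinearMap ∘ₗ TensorProduct.map φ χ

theorem pairEquiv_tmul_mem [Finite α] [Finite β] {e d : ℕ} {p : MvPolynomial (α × Fin 2) F}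
    {q : MvPolynomial (β × Fin 2) F} (hp : p ∈ symForms F α e) (hq : q ∈ symForms F β d) :
    pairEquiv F α β (p ⊗ₜ q) ∈ bisymForms F α β e d := by
  classical
  cases nonempty_fintype α
  cases nonempty_fintype β
  refine ⟨?_, fun σ τ => ?_⟩
  · rw [pairEquiv_tmul]
    convert (isWeightedHomogeneous_relabel Sum.inl hp.1).mul
      (isWeightedHomogeneous_relabel Sum.inr hq.1) using 1
    ext (a | b) <;> simp [mapDomain_apply_eq_sum]
  · rw [← pairEquiv_map_relabel]
    simp [hp.2, hq.2]

/-- The slices of a doubly symmetric form along the monomials in the points of `α`. -/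
theorem lid_slice_mem_symForms [Finite α] [Finite β] {e d : ℕ}
    {t : MvPolynomial (α × Fin 2) F ⊗[F] MvPolynomial (β × Fin 2) F}
    (ht : pairEquiv F α β t ∈ bisymForms F α β e d) (m : α × Fin 2 →₀ ℕ) :
    TensorProduct.lid F _ ((lcoeff F m).rTensor _ t) ∈ symForms F β d := by
  refine ⟨fun n hn => ?_, fun τ => ?_⟩
  · have h1 : coeff n (TensorProduct.lid F _ ((lcoeff F m).rTensor _ t)) =
        coeff (joinExponent m n) (pairEquiv F α β t) := by
      rw [coeff_pairEquiv]
      clear hn ht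
      induction t with
      | zero => simp
      | add s t hs ht => simp only [map_add, coeff_add, hs, ht]
      | tmul p q => simp
    rw [h1] at hn
    have h2 := ht.1 hn
    ext b
    have h3 := DFunLike.congr_fun h2 (Sum.inr b)
    rw [weight_pointWeight_apply, joinExponent_inr, joinExponent_inr] at h3
    rw [weight_pointWeight_apply]
    exact h3
  · have h1 : TensorProduct.map (relabel F id).toLinearMap (relabel F τ).toLinearMap t = t := by
      apply (pairEquiv F α β).injective
      rw [pairEquiv_map_relabel]
      exact ht.2 1 τ
    conv_rhs => rw [← h1]
    clear h1 ht
    induction t with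
    | zero => simp
    | add s t hs ht => simp only [map_add, hs, ht]
    | tmul p q => simp [relabel_id]

/-- The slices of a doubly symmetric form along the monomials in the points of `β`. -/
theorem rid_slice_mem_symForms [Finite α] [Finite β] {e d : ℕ}
    {t : MvPolynomial (α × Fin 2) F ⊗[F] MvPolynomial (β × Fin 2) F}
    (ht : pairEquiv F α β t ∈ bisymForms F α β e d) (n : β × Fin 2 →₀ ℕ) :
    TensorProduct.rid F _ ((lcoeff F n).lTensor _ t) ∈ symForms F α e := by
  refine ⟨fun m hm => ?_, fun σ => ?_⟩
  · have h1 : coeff m (TensorProduct.rid F _ ((lcoeff F n).lTensor _ t)) =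
        coeff (joinExponent m n) (pairEquiv F α β t) := by
      rw [coeff_pairEquiv]
      clear hm ht
      induction t with
      | zero => simp
      | add s t hs ht => simp only [map_add, coeff_add, hs, ht]
      | tmul p q => simp [mul_comm]
    rw [h1] at hm
    have h2 := ht.1 hm
    ext a
    have h3 := DFunLike.congr_fun h2 (Sum.inl a)
    rw [weight_pointWeight_apply, joinExponent_inl, joinExponent_inl] at h3
    rw [weight_pointWeight_apply]
    exact h3
  · have h1 : TensorProduct.map (relabel F σ).toLinearMap (relabel F id).toLinearMap t = t := by
      apply (pairEquiv F α β).injective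
      rw [pairEquiv_map_relabel]
      exact ht.2 σ 1
    conv_rhs => rw [← h1]
    clear h1 ht
    induction t with
    | zero => simp
    | add s t hs ht => simp only [map_add, hs, ht]
    | tmul p q => simp [relabel_id]

theorem IsModel.tprod [Finite α] [Finite β] {A B : Type*} [AddCommGroup A] [Module F A]
    [AddCommGroup B] [Module F B] {ρ : Representation F (Matrix.SpecialLinearGroup (Fin 2) F) A}
    {τ : Representation F (Matrix.SpecialLinearGroup (Fin 2) F) B}
    {φ : A →ₗ[F] MvPolynomial (α × Fin 2) F} {χ : B →ₗ[F] MvPolynomial (β × Fin 2) F} {e d : ℕ}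
    (hφ : IsModel ρ φ (symForms F α e)) (hχ : IsModel τ χ (symForms F β d)) :
    IsModel (ρ.tprod τ) (pairMap φ χ) (bisymForms F α β e d) where
  injective := (pairEquiv F α β).injective.comp
    (TensorProduct.map_injective_of_flat_flat φ χ hφ.injective hχ.injective)
  range_eq := by
    apply le_antisymm
    · rintro _ ⟨t, rfl⟩
      induction t with
      | zero => simp
      | add s t hs ht => rw [map_add]; exact add_mem hs ht
      | tmul a b =>
        exact pairEquiv_tmul_mem (hφ.range_eq ▸ LinearMap.mem_range_self φ a)
          (hχ.range_eq ▸ LinearMap.mem_range_self χ b)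
    · intro h hh
      obtain ⟨t, rfl⟩ := (pairEquiv F α β).surjective h
      have ht := mem_range_mapIncl_of_slices (basisMonomials _ F) (basisMonomials _ F)
        (symForms F α e) (symForms F β d) t (lid_slice_mem_symForms hh) (rid_slice_mem_symForms hh)
      rw [← hφ.range_eq, ← hχ.range_eq, TensorProduct.range_mapIncl,
        ← TensorProduct.range_map] at ht
      obtain ⟨s, rfl⟩ := ht
      exact ⟨s, rfl⟩
  map_smul g t := by
    have h1 : TensorProduct.map φ χ (TensorProduct.map (ρ g) (τ g) t) =
        TensorProduct.map (subst g).toLinearMap (subst g).toLinearMap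
          (TensorProduct.map φ χ t) := by
      induction t with
      | zero => simp
      | add s t hs ht => simp only [map_add, hs, ht]
      | tmul a b => simp [hφ.map_smul, hχ.map_smul]
    rw [Representation.tprod_apply, pairMap, LinearMap.comp_apply, h1]
    exact pairEquiv_map_subst g _

end Tensor

/-! ### Dimensions of lower symmetric powers -/

section Dimension

/-- Two words with the same multiset of letters differ by a permutation of the positions. -/
theorem exists_perm_of_map_univ_eq {n : ℕ} {ι : Type*} {x y : Fin n → ι}
    (h : Finset.univ.val.map x = Finset.univ.val.map y) :
    ∃ σ : Equiv.Perm (Fin n), x ∘ σ = y := by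
  classical
  have hc : ∀ i, Fintype.card {k // y k = i} = Fintype.card {k // x k = i} := by
    intro i
    have := congrArg (Multiset.count i) h
    rw [Multiset.count_map, Multiset.count_map] at this
    rw [Fintype.card_subtype, Fintype.card_subtype]
    simpa [Finset.card, eq_comm] using this.symm
  refine ⟨Equiv.ofFiberEquiv fun i => Fintype.equivOfCardEq (hc i), ?_⟩
  ext k
  exact Equiv.ofFiberEquiv_map _ k

/-- The multiset of letters of a word. -/
def wordContent {n : ℕ} {ι : Type*} (x : Fin n → ι) : Sym ι n :=
  ⟨Finset.univ.val.map x, by simp⟩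

theorem wordContent_comp_perm {n : ℕ} {ι : Type*} (x : Fin n → ι) (σ : Equiv.Perm (Fin n)) :
    wordContent (x ∘ σ) = wordContent x := by
  apply Subtype.ext
  simp only [wordContent]
  rw [← Multiset.map_map, Multiset.map_univ_val_equiv]

theorem wordContent_surjective (n : ℕ) (ι : Type*) :
    Function.Surjective (wordContent : (Fin n → ι) → Sym ι n) := by
  rintro ⟨s, hs⟩
  obtain ⟨l, rfl⟩ := Quot.exists_rep s
  have hl : l.length = n := hs
  subst hl
  refine ⟨l.get, Subtype.ext ?_⟩
  exact (Fin.univ_val_map l.get).trans (congrArg _ (List.ofFn_get l))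

variable {k V ι : Type*} [Field k] [AddCommGroup V] [Module k V]

theorem piTensorProduct_repr_reindex [Fintype ι] {n : ℕ} (b : Module.Basis ι k V)
    (σ : Equiv.Perm (Fin n)) (w : ⨂[k] _ : Fin n, V) (x : Fin n → ι) :
    (Basis.piTensorProduct fun _ : Fin n => b).repr
      (PiTensorProduct.reindex k (fun _ => V) σ w) x =
      (Basis.piTensorProduct fun _ : Fin n => b).repr w (x ∘ σ) := by
  induction w using PiTensorProduct.induction_on with
  | smul_tprod r v =>
    simp only [map_smul, Finsupp.smul_apply]
    rw [PiTensorProduct.reindex_tprod, Basis.piTensorProduct_repr_tprod_apply,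
      Basis.piTensorProduct_repr_tprod_apply]
    congr 1
    rw [← Equiv.prod_comp σ]
    exact Finset.prod_congr rfl fun i _ => by rw [Equiv.symm_apply_apply]; rfl
  | add v w hv hw => simp only [map_add, Finsupp.add_apply, hv, hw]

/-- The dimension of the lower symmetric power is the number of multisets of basis vectors: a
symmetric tensor is a function on words that depends only on the content of the word. -/
theorem finrank_lowerSymSubmodule [Fintype ι] (b : Module.Basis ι k V) (n : ℕ) :
    Module.finrank k (lowerSymSubmodule k V n) = (Fintype.card ι).multichoose n := by
  classical
  let B := Basis.piTensorProduct fun _ : Fin n => b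
  let Φ : (Sym ι n → k) →ₗ[k] ⨂[k] _ : Fin n, V :=
    B.equivFun.symm.toLinearMap ∘ₗ LinearMap.funLeft k k wordContent
  have hΦ : Function.Injective Φ :=
    B.equivFun.symm.injective.comp
      (LinearMap.funLeft_injective_of_surjective k k _ (wordContent_surjective n ι))
  have hrange : LinearMap.range Φ = lowerSymSubmodule k V n := by
    ext w
    constructor
    · rintro ⟨c, rfl⟩ σ
      apply B.repr.injective
      ext x
      rw [piTensorProduct_repr_reindex]
      change B.equivFun (Φ c) _ = B.equivFun (Φ c) _
      simp only [Φ, LinearMap.comp_apply, LinearEquiv.coe_coe, LinearEquiv.apply_symm_apply]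
      exact congrArg c (wordContent_comp_perm x σ)
    · intro hw
      have hf : Function.FactorsThrough (B.equivFun w) wordContent := by
        intro x y hxy
        obtain ⟨σ, rfl⟩ := exists_perm_of_map_univ_eq (congrArg Subtype.val hxy)
        conv_lhs => rw [← hw σ]
        exact piTensorProduct_repr_reindex b σ w x
      refine ⟨Function.extend wordContent (B.equivFun w) 0, B.equivFun.injective ?_⟩
      ext x
      simp only [Φ, LinearMap.comp_apply, LinearEquiv.coe_coe, LinearEquiv.apply_symm_apply]
      exact hf.extend_apply 0 x
  rw [← hrange, LinearMap.finrank_range_of_inj hΦ, Module.finrank_fintype_fun_eq_card,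
    Sym.card_sym_eq_multichoose]

end Dimension

/-! ### Models of symmetric powers -/

section TensorPower

variable {F V : Type*} [Field F] [AddCommGroup V] [Module F V]

/-- A representation `V` is a model of `Sym^d E` if it embeds equivariantly in `F[X, Y]` with
range the forms of degree `d`. -/
structure IsBinaryModel (ρ : Representation F (Matrix.SpecialLinearGroup (Fin 2) F) V)
    (φ : V →ₗ[F] MvPolynomial (Fin 2) F) (d : ℕ) : Prop where
  injective : Function.Injective φ
  range_eq : LinearMap.range φ = homogeneousSubmodule (Fin 2) F d
  map_smul : ∀ g v, φ (ρ g v) = polySubst g (φ v)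

/-- The basis of `V` that the model sends to the monomials. -/
theorem IsBinaryModel.exists_basis {ρ : Representation F (Matrix.SpecialLinearGroup (Fin 2) F) V}
    {φ : V →ₗ[F] MvPolynomial (Fin 2) F} {d : ℕ} (hφ : IsBinaryModel ρ φ d) :
    ∃ b : Module.Basis (Fin (d + 1)) F V, ∀ k, φ (b k) = monomial (binaryExponent d k) 1 := by
  have hmem : ∀ k, ∃ v, φ v = monomial (binaryExponent d k) 1 := by
    intro k
    have : monomial (binaryExponent d k) (1 : F) ∈ LinearMap.range φ := by
      rw [hφ.range_eq]
      exact isHomogeneous_monomial _ (degree_binaryExponent d k)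
    exact this
  choose v hv using hmem
  have hli : LinearIndependent F v := by
    refine LinearIndependent.of_comp φ ?_
    rw [show φ ∘ v = basisMonomials (Fin 2) F ∘ binaryExponent d from
      funext fun k => by simp [hv]]
    exact (basisMonomials (Fin 2) F).linearIndependent.comp _ (binaryExponent_injective d)
  refine ⟨Module.Basis.mk hli fun w _ => ?_, fun k => by rw [Module.Basis.mk_apply, hv]⟩
  have hw : (φ w).IsHomogeneous d := by
    rw [← mem_homogeneousSubmodule, ← hφ.range_eq]
    exact LinearMap.mem_range_self φ w
  have : w = ∑ k, coeff (binaryExponent d k) (φ w) • v k := by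
    apply hφ.injective
    conv_lhs => rw [eq_sum_monomial_binaryExponent hw]
    simp [hv, smul_monomial]
  rw [this]
  exact sum_mem fun k _ => Submodule.smul_mem _ _ (Submodule.subset_span ⟨k, rfl⟩)

/-- The tensor power of `V` as polynomials in the coordinates of `n` points: the `i`-th tensor
position becomes a form in the `i`-th point. -/
noncomputable def tensorPowerMap (φ : V →ₗ[F] MvPolynomial (Fin 2) F) (n : ℕ) :
    (⨂[F] _ : Fin n, V) →ₗ[F] MvPolynomial (Fin n × Fin 2) F :=
  PiTensorProduct.lift ((MultilinearMap.mkPiAlgebra F (Fin n) _).compLinearMap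
    fun i => (place F i).toLinearMap ∘ₗ φ)

theorem tensorPowerMap_tprod (φ : V →ₗ[F] MvPolynomial (Fin 2) F) {n : ℕ} (v : Fin n → V) :
    tensorPowerMap φ n (PiTensorProduct.tprod F v) = ∏ i, place F i (φ (v i)) := by
  simp [tensorPowerMap]

theorem tensorPowerMap_reindex (φ : V →ₗ[F] MvPolynomial (Fin 2) F) {n : ℕ}
    (σ : Equiv.Perm (Fin n)) (w : ⨂[F] _ : Fin n, V) :
    tensorPowerMap φ n (PiTensorProduct.reindex F (fun _ => V) σ w) =
      relabel F σ (tensorPowerMap φ n w) := by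
  induction w using PiTensorProduct.induction_on with
  | smul_tprod r v =>
    simp only [map_smul]
    rw [PiTensorProduct.reindex_tprod, tensorPowerMap_tprod, tensorPowerMap_tprod, map_prod,
      ← Equiv.prod_comp σ]
    congr 1
    exact Finset.prod_congr rfl fun i _ => by rw [relabel_place, Equiv.symm_apply_apply]
  | add v w hv hw => simp only [map_add, hv, hw]

theorem tensorPowerMap_tensorPower {ρ : Representation F (Matrix.SpecialLinearGroup (Fin 2) F) V}
    {φ : V →ₗ[F] MvPolynomial (Fin 2) F} {d : ℕ} (hφ : IsBinaryModel ρ φ d) {n : ℕ}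
    (g : Matrix.SpecialLinearGroup (Fin 2) F) (w : ⨂[F] _ : Fin n, V) :
    tensorPowerMap φ n (tensorPower ρ n g w) = subst g (tensorPowerMap φ n w) := by
  induction w using PiTensorProduct.induction_on with
  | smul_tprod r v =>
    simp only [map_smul]
    congr 1
    change tensorPowerMap φ n (PiTensorProduct.map (fun _ => ρ g) _) = _
    rw [PiTensorProduct.map_tprod, tensorPowerMap_tprod, tensorPowerMap_tprod, map_prod]
    exact Finset.prod_congr rfl fun i _ => by rw [hφ.map_smul, subst_place]
  | add v w hv hw => simp only [map_add, hv, hw]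

theorem isWeightedHomogeneous_tensorPowerMap
    {ρ : Representation F (Matrix.SpecialLinearGroup (Fin 2) F) V}
    {φ : V →ₗ[F] MvPolynomial (Fin 2) F} {d : ℕ} (hφ : IsBinaryModel ρ φ d) {n : ℕ}
    (w : ⨂[F] _ : Fin n, V) :
    IsWeightedHomogeneous (pointWeight (Fin n)) (tensorPowerMap φ n w)
      (Finsupp.equivFunOnFinite.symm fun _ => d) := by
  induction w using PiTensorProduct.induction_on with
  | smul_tprod r v =>
    rw [map_smul, tensorPowerMap_tprod]
    refine (weightedHomogeneousSubmodule F _ _).smul_mem r ?_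
    have hdeg : ∑ i : Fin n, Finsupp.single i d = Finsupp.equivFunOnFinite.symm fun _ => d := by
      ext i
      simp [Finsupp.single_apply]
    rw [mem_weightedHomogeneousSubmodule, ← hdeg]
    refine IsWeightedHomogeneous.prod _ _ _ fun i _ => isWeightedHomogeneous_place i ?_
    rw [← mem_homogeneousSubmodule, ← hφ.range_eq]
    exact LinearMap.mem_range_self φ _
  | add v w hv hw => rw [map_add]; exact hv.add hw

/-- The exponent of the monomial attached to a word of basis vectors. -/
noncomputable def wordExponent {n d : ℕ} (x : Fin n → Fin (d + 1)) : Fin n × Fin 2 →₀ ℕ :=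
  Finsupp.equivFunOnFinite.symm fun p => binaryExponent d (x p.1) p.2

theorem wordExponent_injective (n d : ℕ) :
    Function.Injective (wordExponent : (Fin n → Fin (d + 1)) → _) := by
  intro x y h
  ext1 i
  apply binaryExponent_injective d
  ext j
  exact DFunLike.congr_fun h (i, j)

theorem exists_wordExponent_eq {n d : ℕ} {s : Fin n × Fin 2 →₀ ℕ}
    (hs : Finsupp.weight (pointWeight (Fin n)) s = Finsupp.equivFunOnFinite.symm fun _ => d) :
    ∃ x : Fin n → Fin (d + 1), wordExponent x = s := by
  have h : ∀ i, ∃ k, binaryExponent d k = Finsupp.equivFunOnFinite.symm fun j => s (i, j) := by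
    intro i
    apply exists_binaryExponent_eq
    have := DFunLike.congr_fun hs i
    rw [weight_pointWeight_apply] at this
    rw [Finsupp.degree_eq_sum, Fin.sum_univ_two]
    exact this
  choose x hx using h
  refine ⟨x, ?_⟩
  ext ⟨i, j⟩
  exact DFunLike.congr_fun (hx i) j

theorem prod_place_monomial {n d : ℕ} (x : Fin n → Fin (d + 1)) :
    ∏ i, place F i (monomial (binaryExponent d (x i)) 1) = monomial (wordExponent x) 1 := by
  simp only [place, rename_monomial]
  rw [← monomial_sum_one]
  refine congrArg (fun s => monomial s (1 : F)) (Finsupp.ext fun ⟨i, j⟩ => ?_)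
  rw [Finsupp.finsetSum_apply, Finset.sum_eq_single i]
  · exact Finsupp.mapDomain_apply (Prod.mk_right_injective i) _ j
  · intro l _ hl
    refine Finsupp.mapDomain_of_notMem_range _ _ ?_
    rintro ⟨m, hm⟩
    exact hl (congrArg Prod.fst hm)
  · simp

theorem coeff_tensorPowerMap {φ : V →ₗ[F] MvPolynomial (Fin 2) F} {n d : ℕ}
    {b : Module.Basis (Fin (d + 1)) F V} (hb : ∀ k, φ (b k) = monomial (binaryExponent d k) 1)
    (x : Fin n → Fin (d + 1)) (w : ⨂[F] _ : Fin n, V) :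
    coeff (wordExponent x) (tensorPowerMap φ n w) =
      (Basis.piTensorProduct fun _ : Fin n => b).repr w x := by
  classical
  suffices h : lcoeff F (wordExponent x) ∘ₗ tensorPowerMap φ n =
      (Basis.piTensorProduct fun _ : Fin n => b).coord x from LinearMap.congr_fun h w
  refine (Basis.piTensorProduct fun _ : Fin n => b).ext fun y => ?_
  rw [LinearMap.comp_apply, Basis.piTensorProduct_apply, tensorPowerMap_tprod]
  simp only [hb]
  rw [prod_place_monomial, lcoeff_apply, coeff_monomial,
    ← Basis.piTensorProduct_apply, Module.Basis.coord_apply, Module.Basis.repr_self,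
    Finsupp.single_apply]
  simp only [(wordExponent_injective n d).eq_iff]

/-- `Sym_n` of a model of `Sym^d E` is the space of symmetric forms of degree `d` in `n` points. -/
theorem IsBinaryModel.lowerSym {ρ : Representation F (Matrix.SpecialLinearGroup (Fin 2) F) V}
    {φ : V →ₗ[F] MvPolynomial (Fin 2) F} {d : ℕ} (hφ : IsBinaryModel ρ φ d) (n : ℕ) :
    IsModel (lowerSym ρ n) (tensorPowerMap φ n ∘ₗ (lowerSymSubmodule F V n).subtype)
      (symForms F (Fin n) d) := by
  obtain ⟨b, hb⟩ := hφ.exists_basis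
  have hinj : Function.Injective (tensorPowerMap φ n) := by
    intro v w hvw
    apply (Basis.piTensorProduct fun _ : Fin n => b).repr.injective
    ext x
    rw [← coeff_tensorPowerMap hb, hvw, coeff_tensorPowerMap hb]
  refine ⟨hinj.comp Subtype.val_injective, le_antisymm ?_ fun h hh => ?_, fun g v => ?_⟩
  · rintro _ ⟨w, rfl⟩
    refine ⟨isWeightedHomogeneous_tensorPowerMap hφ _, fun σ => ?_⟩
    rw [LinearMap.comp_apply, ← tensorPowerMap_reindex]
    exact congrArg _ (w.2 σ)
  · let w := (Basis.piTensorProduct fun _ : Fin n => b).equivFun.symm fun x =>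
      coeff (wordExponent x) h
    have hw : tensorPowerMap φ n w = h := by
      ext s
      by_cases hs : Finsupp.weight (pointWeight (Fin n)) s =
          Finsupp.equivFunOnFinite.symm fun _ => d
      · obtain ⟨x, rfl⟩ := exists_wordExponent_eq hs
        rw [coeff_tensorPowerMap hb]
        exact congrFun ((Basis.piTensorProduct fun _ : Fin n => b).equivFun.apply_symm_apply _) x
      · rw [(isWeightedHomogeneous_tensorPowerMap hφ w).coeff_eq_zero s hs,
          hh.1.coeff_eq_zero s hs]
    refine ⟨⟨w, fun σ => hinj ?_⟩, hw⟩
    rw [tensorPowerMap_reindex, hw, hh.2 σ]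
  · exact tensorPowerMap_tensorPower hφ g v.1

theorem IsBinaryModel.finrank_lowerSym
    {ρ : Representation F (Matrix.SpecialLinearGroup (Fin 2) F) V}
    {φ : V →ₗ[F] MvPolynomial (Fin 2) F} {d : ℕ} (hφ : IsBinaryModel ρ φ d) (n : ℕ) :
    Module.finrank F (lowerSymSubmodule F V n) = (d + n).choose n := by
  obtain ⟨b, -⟩ := hφ.exists_basis
  rw [finrank_lowerSymSubmodule b, Fintype.card_fin, Nat.multichoose_eq]
  congr 1
  omega

theorem isBinaryModel_upperSym (d : ℕ) :
    IsBinaryModel (upperSym F d) (homogeneousSubmodule (Fin 2) F d).subtype d :=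
  ⟨Subtype.val_injective, Submodule.range_subtype _, fun _ _ => rfl⟩

theorem finrank_homogeneousSubmodule (d : ℕ) :
    Module.finrank F (homogeneousSubmodule (Fin 2) F d) = d + 1 := by
  obtain ⟨b, -⟩ := (isBinaryModel_upperSym (F := F) d).exists_basis
  rw [Module.finrank_eq_card_basis b, Fintype.card_fin]

/-- The natural representation is `Sym^1 E`: a vector is read as a linear form. -/
theorem isBinaryModel_natural :
    IsBinaryModel (natural F) (Fintype.linearCombination F (X : Fin 2 → MvPolynomial (Fin 2) F))
      1 := by
  refine ⟨?_, ?_, fun g v => ?_⟩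
  · exact linearIndependent_iff_injective_fintypeLinearCombination.1 (linearIndependent_X (Fin 2) F)
  · rw [Fintype.range_linearCombination, homogeneousSubmodule_one_eq_span_X]
  · simp [natural, polySubst, Fintype.linearCombination_apply, Fin.sum_univ_two, smul_eq_C_mul]
    ring

/-- `Sym^e E` in the coordinates of a single point. -/
theorem isModel_upperSym (e : ℕ) :
    IsModel (upperSym F e)
      ((place F ()).toLinearMap ∘ₗ (homogeneousSubmodule (Fin 2) F e).subtype)
      (symForms F Unit e) := by
  refine ⟨(rename_injective _ (Prod.mk_right_injective ())).comp Subtype.val_injective,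
    le_antisymm ?_ fun h hh => ?_, fun g v => (subst_place g () v.1).symm⟩
  · rintro _ ⟨p, rfl⟩
    refine ⟨?_, fun σ => ?_⟩
    · have hdeg : (Finsupp.equivFunOnFinite.symm fun _ => e) = Finsupp.single () e :=
        Finsupp.ext fun _ => Finsupp.single_eq_same.symm
      rw [hdeg]
      exact isWeightedHomogeneous_place () p.2
    · rw [Subsingleton.elim σ 1]
      exact relabel_id _
  · have hhom : (rename Prod.snd h).IsHomogeneous
        (Finsupp.applyAddHom () (Finsupp.equivFunOnFinite.symm fun _ => e)) :=
      isWeightedHomogeneous_rename Prod.snd _ (fun p => by simp [pointWeight]) hh.1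
    refine ⟨⟨rename Prod.snd h, hhom⟩, ?_⟩
    change rename (Prod.mk ()) (rename Prod.snd h) = h
    rw [rename_rename]
    exact rename_id_apply h

end TensorPower

/-! ### The isomorphisms -/

/-- A map of points that is injective on a model induces an isomorphism with any representation of
the same dimension whose model contains the image. -/
theorem nonempty_equiv_of_isModel {F V W : Type*} [Field F] [AddCommGroup V] [Module F V]
    [AddCommGroup W] [Module F W] {α β : Type*}
    {ρ : Representation F (Matrix.SpecialLinearGroup (Fin 2) F) V}
    {τ : Representation F (Matrix.SpecialLinearGroup (Fin 2) F) W}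
    {φ : V →ₗ[F] MvPolynomial (α × Fin 2) F} {χ : W →ₗ[F] MvPolynomial (β × Fin 2) F}
    {S : Submodule F (MvPolynomial (α × Fin 2) F)} {T : Submodule F (MvPolynomial (β × Fin 2) F)}
    (hρ : IsModel ρ φ S) (hτ : IsModel τ χ T) (f : α → β)
    (hST : ∀ h ∈ S, relabel F f h ∈ T) (hf : ∀ h ∈ S, relabel F f h = 0 → h = 0)
    (hfin : Module.finrank F V = Module.finrank F W) (hpos : 0 < Module.finrank F W) :
    Nonempty (Representation.Equiv ρ τ) := by
  have hS : ∀ v, φ v ∈ S := fun v => hρ.range_eq ▸ LinearMap.mem_range_self φ v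
  let e : W ≃ₗ[F] T :=
    (LinearEquiv.ofInjective χ hτ.injective).trans (LinearEquiv.ofEq _ _ hτ.range_eq)
  have he : ∀ t : T, χ (e.symm t) = t := fun t =>
    congrArg Subtype.val (e.apply_symm_apply t)
  let Φ : V →ₗ[F] W := e.symm.toLinearMap ∘ₗ
    ((relabel F f).toLinearMap ∘ₗ φ).codRestrict T fun v => hST _ (hS v)
  have hΦ : ∀ v, χ (Φ v) = relabel F f (φ v) := fun v => he _
  have hinj : Function.Injective Φ := by
    refine (injective_iff_map_eq_zero Φ).2 fun v hv => ?_
    apply hρ.injective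
    rw [map_zero]
    refine hf _ (hS v) ?_
    rw [← hΦ, hv, map_zero]
  have := Module.finite_of_finrank_pos hpos
  have := Module.finite_of_finrank_pos (hfin ▸ hpos)
  refine ⟨Representation.Equiv.mk (LinearEquiv.ofInjectiveOfFinrankEq Φ hinj hfin) fun g => ?_⟩
  ext v
  apply hτ.injective
  change χ (Φ (ρ g v)) = χ (τ g (Φ v))
  rw [hΦ, hρ.map_smul, hτ.map_smul, hΦ, subst_relabel]

theorem succ_mul_choose_succ (d K : ℕ) :
    (d + 1) * (d + 1 + K).choose K = (d + K + 1) * (d + K).choose K := by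
  rw [Nat.choose_symm_add.symm, ← Nat.choose_symm_add, add_right_comm, Nat.add_one_mul_choose_eq,
    mul_comm]

section Isomorphisms

variable {F V W N : Type*} [Field F] [AddCommGroup V] [Module F V] [AddCommGroup W] [Module F W]
  [AddCommGroup N] [Module F N]
  {ρ : Representation F (Matrix.SpecialLinearGroup (Fin 2) F) V}
  {τ : Representation F (Matrix.SpecialLinearGroup (Fin 2) F) W}
  {ν : Representation F (Matrix.SpecialLinearGroup (Fin 2) F) N}
  {φ : V →ₗ[F] MvPolynomial (Fin 2) F} {χ : W →ₗ[F] MvPolynomial (Fin 2) F}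
  {η : N →ₗ[F] MvPolynomial (Fin 2) F} {d : ℕ}

/-- `Sym^K E ⊗ Sym_{K+1} Sym^d E ≅ Sym^{d+K} E ⊗ Sym_K Sym^d E`. -/
theorem nonempty_equiv_collideOuter (hφ : IsBinaryModel ρ φ d) (K : ℕ) :
    Nonempty (Representation.Equiv ((upperSym F K).tprod (lowerSym ρ (K + 1)))
      ((upperSym F (d + K)).tprod (lowerSym ρ K))) := by
  refine nonempty_equiv_of_isModel ((isModel_upperSym K).tprod (hφ.lowerSym (K + 1)))
    ((isModel_upperSym (d + K)).tprod (hφ.lowerSym K)) (collideOuter K)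
    (fun _ => relabel_collideOuter_mem) (fun _ => eq_zero_of_relabel_collideOuter) ?_ ?_ <;>
  simp only [Module.finrank_tensorProduct, finrank_homogeneousSubmodule, hφ.finrank_lowerSym]
  · rw [← add_assoc, Nat.add_one_mul_choose_eq, mul_comm]
  · exact Nat.mul_pos (Nat.succ_pos _) (Nat.choose_pos (Nat.le_add_left _ _))

/-- `Sym_K E ⊗ Sym_{K+1} Sym^d E ≅ Sym^d E ⊗ Sym_K Sym^{d+1} E`. -/
theorem nonempty_equiv_collideAllButOne (hη : IsBinaryModel ν η 1) (hφ : IsBinaryModel ρ φ d)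
    (hχ : IsBinaryModel τ χ (d + 1)) (K : ℕ) :
    Nonempty (Representation.Equiv ((lowerSym ν K).tprod (lowerSym ρ (K + 1)))
      ((upperSym F d).tprod (lowerSym τ K))) := by
  refine nonempty_equiv_of_isModel ((hη.lowerSym K).tprod (hφ.lowerSym (K + 1)))
    ((isModel_upperSym d).tprod (hχ.lowerSym K)) (collideAllButOne K)
    (fun _ => relabel_collideAllButOne_mem) (fun _ => eq_zero_of_relabel_collideAllButOne) ?_ ?_ <;>
  simp only [Module.finrank_tensorProduct, finrank_homogeneousSubmodule, hη.finrank_lowerSym,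
    hφ.finrank_lowerSym, hχ.finrank_lowerSym]
  · rw [succ_mul_choose_succ, add_comm 1 K, Nat.choose_succ_self_right, ← add_assoc,
      Nat.add_one_mul_choose_eq, mul_comm]
  · exact Nat.mul_pos (Nat.succ_pos _) (Nat.choose_pos (Nat.le_add_left _ _))

/-- `Sym_{d+K} E ⊗ Sym_K Sym^d E ≅ Sym_d E ⊗ Sym_K Sym^{d+1} E`. -/
theorem nonempty_equiv_collideAll (hη : IsBinaryModel ν η 1) (hφ : IsBinaryModel ρ φ d)
    (hχ : IsBinaryModel τ χ (d + 1)) (K : ℕ) :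
    Nonempty (Representation.Equiv ((lowerSym ν (d + K)).tprod (lowerSym ρ K))
      ((lowerSym ν d).tprod (lowerSym τ K))) := by
  refine nonempty_equiv_of_isModel ((hη.lowerSym (d + K)).tprod (hφ.lowerSym K))
    ((hη.lowerSym d).tprod (hχ.lowerSym K)) (collideAll d K)
    (fun _ => relabel_collideAll_mem) (fun _ => eq_zero_of_relabel_collideAll) ?_ ?_ <;>
  simp only [Module.finrank_tensorProduct, hη.finrank_lowerSym,
    hφ.finrank_lowerSym, hχ.finrank_lowerSym]
  · rw [add_comm 1 d, add_comm 1 (d + K), Nat.choose_succ_self_right, Nat.choose_succ_self_right,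
      succ_mul_choose_succ]
  · exact Nat.mul_pos (Nat.choose_pos (Nat.le_add_left _ _))
      (Nat.choose_pos (Nat.le_add_left _ _))

end Isomorphisms

end SL2Plethysm

theorem corollary1p3 (F : Type*) [Field F] (K d : ℕ) :
    Nonempty (Representation.Equiv
      ((SL2Plethysm.upperSym F (d + K)).tprod
        (SL2Plethysm.lowerSym (SL2Plethysm.upperSym F d) K))
      ((SL2Plethysm.upperSym F K).tprod
        (SL2Plethysm.lowerSym (SL2Plethysm.upperSym F d) (K + 1)))) ∧
    Nonempty (Representation.Equiv
      ((SL2Plethysm.lowerSym (SL2Plethysm.natural F) K).tprod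
        (SL2Plethysm.lowerSym (SL2Plethysm.upperSym F d) (K + 1)))
      ((SL2Plethysm.upperSym F d).tprod
        (SL2Plethysm.lowerSym (SL2Plethysm.upperSym F (d + 1)) K))) ∧
    Nonempty (Representation.Equiv
      ((SL2Plethysm.lowerSym (SL2Plethysm.natural F) (d + K)).tprod
        (SL2Plethysm.lowerSym (SL2Plethysm.upperSym F d) K))
      ((SL2Plethysm.lowerSym (SL2Plethysm.natural F) d).tprod
        (SL2Plethysm.lowerSym (SL2Plethysm.upperSym F (d + 1)) K))) :=
  ⟨(SL2Plethysm.nonempty_equiv_collideOuter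
      (SL2Plethysm.isBinaryModel_upperSym d) K).map Representation.Equiv.symm,
    SL2Plethysm.nonempty_equiv_collideAllButOne SL2Plethysm.isBinaryModel_natural
      (SL2Plethysm.isBinaryModel_upperSym d) (SL2Plethysm.isBinaryModel_upperSym (d + 1)) K,
    SL2Plethysm.nonempty_equiv_collideAll SL2Plethysm.isBinaryModel_natural
      (SL2Plethysm.isBinaryModel_upperSym d) (SL2Plethysm.isBinaryModel_upperSym (d + 1)) K⟩
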